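/- Let $(\Omega,\mu)$ be a probability space (for instance an interval $I\subseteq\mathbb R$ with the measure $dF$ of a distribution function $F$) and let $a:\Omega\to\mathbb R$ be measurable, not almost everywhere constant, with $\xi:=\operatorname{ess\,inf} a>-\infty$. Put $E:=\int a\,d\mu\in(\xi,\infty]$. For a profit function $b:\Omega\to\mathbb R$ with $\xi_b:=\operatorname{ess\,inf}b>-\infty$ and a price $u>0$, let $A_u:=\{t\in[0,1]:\ \xi_b t/u-t+1>0\}$. A number $t_u\in\overline{A_u}$ is called an optimal proportion of investment at price $u$ if for every $t\in A_u$ $$\limsup_{\rho\to t_u,\ \rho\in A_u}\ \int \log\frac{b\,t/u-t+1}{b\,\rho/u-\rho+1}\,d\mu\ \le\ 0 .$$ For each $m\in(\xi,E)$ consider the translated profit function $b=a-m$, and write $\underline t_u$ for its optimal proportion at price $u$; it exists and is unique for all $0<u<E-m$, and there is a unique $\underline u_{\max}=\underline u_{\max}(m)\in(0,E-m)$ such that $u\mapsto\underline t_u$ is strictly increasing on $(0,\underline u_{\max})$ and strictly decreasing on $(\underline u_{\max},E-m)$. Then $m\mapsto\underline u_{\max}(m)$ is differentiable for all $m<E$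 sufficiently close to $E$ (sufficiently large, if $E=\infty$), and its derivative with respect to $m$ satisfies $$\liminf_{m\to E^-}\ \underline u_{\max}'(m)\ \ge\ -\tfrac12 ,$$ where $m\to E^-$ means $m\to\infty$ if $E=\infty$. -/

import Mathlib

open MeasureTheory Filter Topology

noncomputable section

namespace Game

variable {Ω : Type*} [MeasurableSpace Ω]

/-- The integral of a real function with values in `[-∞, ∞]`: the integral of the positive part
minus the integral of the negative part.  Below it is only applied to functions one of whose two
parts is bounded, so `∞ - ∞` does not occur. -/
def extIntegral (μ : Measure Ω) (f : Ω → ℝ) : EReal :=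
  ((∫⁻ x, ENNReal.ofReal (f x) ∂μ : ENNReal) : EReal) -
    ((∫⁻ x, ENNReal.ofReal (-f x) ∂μ : ENNReal) : EReal)

/-- The proportions `t ∈ [0, 1]` with `ξ t / u - t + 1 > 0`, where `ξ = ess inf b`, for the game
with profit function `b` at price `u`. -/
def admissible (μ : Measure Ω) (b : Ω → ℝ) (u : ℝ) : Set ℝ :=
  {t | 0 ≤ t ∧ t ≤ 1 ∧ 0 < essInf b μ * t / u - t + 1}

/-- `t` is an optimal proportion of investment for the game with profit function `b` at price `u`:
for each admissible `s`, the upper limit as `ρ → t` through admissible `ρ` of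
`∫ log ((b s / u - s + 1) / (b ρ / u - ρ + 1))` is at most `0`.  The value `t` itself may be a
boundary point of the set of admissible proportions. -/
def IsOptimalProportion (μ : Measure Ω) (b : Ω → ℝ) (u t : ℝ) : Prop :=
  t ∈ closure (admissible μ b u) ∧
    ∀ s ∈ admissible μ b u,
      limsup (fun ρ : ℝ => extIntegral μ (fun x =>
          Real.log ((b x * s / u - s + 1) / (b x * ρ / u - ρ + 1))))
        (𝓝[admissible μ b u] t) ≤ 0

/-- The optimal proportion of investment `t_u` of the game with profit function `b`. -/
def optimalProportion (μ : Measure Ω) (b : Ω → ℝ) (u : ℝ) : ℝ :=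
  Classical.epsilon (IsOptimalProportion μ b u)

/-- `v` is a price in `(0, E)`, where `E = ∫ b`, such that `u ↦ t_u` is strictly increasing for
`0 < u < v` and strictly decreasing for `v < u < E`. -/
def IsPeakPrice (μ : Measure Ω) (b : Ω → ℝ) (v : ℝ) : Prop :=
  0 < v ∧ (v : EReal) < extIntegral μ b ∧
    StrictMonoOn (optimalProportion μ b) {u | 0 < u ∧ u < v} ∧
    StrictAntiOn (optimalProportion μ b) {u | v < u ∧ (u : EReal) < extIntegral μ b}

/-- The price `u_max` of the game with parallel translated profit `a - m`, as a function
of `m`. -/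
def uMax (μ : Measure Ω) (a : Ω → ℝ) (m : ℝ) : ℝ :=
  Classical.epsilon (IsPeakPrice μ (fun x => a x - m))

/-- The filter on `ℝ` of `m → E⁻`, for `E ∈ (-∞, ∞]`; for `E = ∞` this is `m → ∞`. -/
def tendsToLeft (E : EReal) : Filter ℝ :=
  comap (fun m : ℝ => (m : EReal)) (𝓝[<] E)

end Game

end

namespace Game

variable {Ω : Type*} [MeasurableSpace Ω]

/-! Subtract the essential infimum: `c = a - ξ ≥ 0` and `n = m - ξ > 0`. Write G_j(x) = ∫ (c + x)⁻ʲ.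
The substitution x = u/ρ - u - n turns the payoff at ρ into (ρ/u)(c + x). Stationarity of the
expected logarithm becomes K(x) = n + u, with K = 1/G₁ - x (`harmonicShift`). K is strictly
increasing, so either there is one root X > 0, or K > n + u throughout and X = 0; both cases give
t_u = u/(X + n + u).

Where X > 0, t_u = 1 - (X + n) G₁(X), whose derivative in X is G₂ (n - M), with M = G₁/G₂ - x
(`stationaryShift`). By Cauchy–Schwarz M is strictly increasing, so the peak lies at M(x) = n. Thus
n = M(x), u_max = K(x) - M(x) is a parametrised curve, and u_max' = K'/M' - 1 (`hasDerivAt_uMax`).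

Here K' = (G₂ - G₁²)/G₁² and M' = 2(G₁G₃ - G₂²)/G₂². The inequality `invMoment_gap_le` together with
G₂ ≥ G₁² gives K'/M' ≥ x G₁(x)/2. Since M < K < ∫ c while M exceeds every number below ∫ c
(`exists_lt_stationaryShift`), m → E forces x → ∞. Then x G₁(x) → 1, which yields -1/2. -/

/-- The moment `∫ (c + x)⁻ʲ` of a translated function. -/
noncomputable def invMoment (μ : Measure Ω) (c : Ω → ℝ) (j : ℕ) (x : ℝ) : ℝ :=
  ∫ ω, ((c ω + x)⁻¹) ^ j ∂μ

/-- The translated harmonic mean `1 / ∫ (c + x)⁻¹ - x`. -/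
noncomputable def harmonicShift (μ : Measure Ω) (c : Ω → ℝ) (x : ℝ) : ℝ :=
  (invMoment μ c 1 x)⁻¹ - x

/-- The translation at which the interior optimal proportion is stationary at parameter `x`. -/
noncomputable def stationaryShift (μ : Measure Ω) (c : Ω → ℝ) (x : ℝ) : ℝ :=
  invMoment μ c 1 x / invMoment μ c 2 x - x

/-- The optimal proportion `1 - (x + n) ∫ (c + x)⁻¹` in terms of the parameter `x`. -/
noncomputable def interiorProportion (μ : Measure Ω) (c : Ω → ℝ) (n x : ℝ) : ℝ :=
  1 - (x + n) * invMoment μ c 1 x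

/-! ### Inverse moments: derivatives, Cauchy–Schwarz inequalities, monotonicity. -/

section Moments

variable {μ : Measure Ω} [IsProbabilityMeasure μ] {c : Ω → ℝ}

theorem integrable_inv_pow (hc : AEMeasurable c μ) (h0 : ∀ᵐ ω ∂μ, 0 ≤ c ω) {x : ℝ} (hx : 0 < x)
    (j : ℕ) : Integrable (fun ω => ((c ω + x)⁻¹) ^ j) μ := by
  refine Integrable.of_bound (C := (x⁻¹) ^ j)
    ((hc.add_const x).inv.pow_const j).aestronglyMeasurable ?_
  filter_upwards [h0] with ω hω
  have h1 : 0 < c ω + x := by linarith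
  rw [Real.norm_of_nonneg (by positivity)]
  gcongr
  linarith

theorem invMoment_zero (x : ℝ) : invMoment μ c 0 x = 1 := by
  simp [invMoment]

theorem invMoment_pos (hc : AEMeasurable c μ) (h0 : ∀ᵐ ω ∂μ, 0 ≤ c ω) {x : ℝ} (hx : 0 < x)
    (j : ℕ) : 0 < invMoment μ c j x := by
  have hp : ∀ᵐ ω ∂μ, 0 < ((c ω + x)⁻¹) ^ j := by
    filter_upwards [h0] with ω hω
    positivity
  refine lt_of_le_of_ne (integral_nonneg_of_ae (hp.mono fun _ h => h.le)) fun h => ?_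
  have h2 := (integral_eq_zero_iff_of_nonneg_ae (hp.mono fun _ h => h.le)
    (integrable_inv_pow hc h0 hx j)).1 h.symm
  obtain ⟨ω, h3, h4⟩ := (hp.and h2).exists
  exact absurd h4 h3.ne'

theorem hasDerivAt_invMoment (hc : AEMeasurable c μ) (h0 : ∀ᵐ ω ∂μ, 0 ≤ c ω) {x : ℝ}
    (hx : 0 < x) (j : ℕ) :
    HasDerivAt (invMoment μ c j) (-(j * invMoment μ c (j + 1) x)) x := by
  -- On (x/2, ∞) the derivative in y is bounded by a constant, which is integrable for a probability
  -- measure.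
  have key := hasDerivAt_integral_of_dominated_loc_of_deriv_le (μ := μ)
    (F := fun y ω => ((c ω + y)⁻¹) ^ j) (F' := fun y ω => -(j * ((c ω + y)⁻¹) ^ (j + 1)))
    (x₀ := x) (s := Set.Ioi (x / 2)) (bound := fun _ => j * ((x / 2)⁻¹) ^ (j + 1))
    (Ioi_mem_nhds (by linarith))
    (Eventually.of_forall fun y => ((hc.add_const y).inv.pow_const j).aestronglyMeasurable)
    (integrable_inv_pow hc h0 hx j)
    (((hc.add_const x).inv.pow_const (j + 1)).const_mul (j : ℝ)).neg.aestronglyMeasurable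
    (by
      filter_upwards [h0] with ω hω y hy
      have hy' : x / 2 < y := hy
      have h1 : 0 < c ω + y := by linarith
      rw [norm_neg, Real.norm_of_nonneg (by positivity)]
      gcongr
      linarith)
    (integrable_const _)
    (by
      filter_upwards [h0] with ω hω y hy
      have hy' : x / 2 < y := hy
      have h1 : c ω + y ≠ 0 := by linarith
      have h2 := (((hasDerivAt_id y).const_add (c ω)).inv h1).pow j
      refine h2.congr_deriv ?_
      rcases j with _ | j
      · simp
      · simp only [Nat.add_sub_cancel, id, Pi.inv_apply]
        rw [neg_div, one_div, ← inv_pow]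
        ring)
  have h3 := key.2
  rw [integral_neg, integral_const_mul] at h3
  exact h3

theorem integral_inv_pow_mul_sq (hc : AEMeasurable c μ) (h0 : ∀ᵐ ω ∂μ, 0 ≤ c ω) {x : ℝ}
    (hx : 0 < x) (i : ℕ) (θ : ℝ) :
    Integrable (fun ω => ((c ω + x)⁻¹) ^ i * ((c ω + x)⁻¹ - θ) ^ 2) μ ∧
    ∫ ω, ((c ω + x)⁻¹) ^ i * ((c ω + x)⁻¹ - θ) ^ 2 ∂μ =
      invMoment μ c (i + 2) x - 2 * θ * invMoment μ c (i + 1) x + θ ^ 2 * invMoment μ c i x := by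
  have I := integrable_inv_pow hc h0 hx
  have e : (fun ω => ((c ω + x)⁻¹) ^ i * ((c ω + x)⁻¹ - θ) ^ 2) =
      fun ω => ((c ω + x)⁻¹) ^ (i + 2) - 2 * θ * ((c ω + x)⁻¹) ^ (i + 1) +
        θ ^ 2 * ((c ω + x)⁻¹) ^ i := by
    ext ω; ring
  have i1 := (I (i + 1)).const_mul (2 * θ)
  have i2 := (I i).const_mul (θ ^ 2)
  rw [e]
  refine ⟨((I (i + 2)).sub i1).add i2, ?_⟩
  refine (integral_add ((I (i + 2)).sub i1) i2).trans ?_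
  simp only [Pi.sub_apply]
  rw [integral_sub (I (i + 2)) i1, integral_const_mul, integral_const_mul]
  rfl

/-- This is the integral of a positive weight times ((c + x)⁻¹ - θ)². It could vanish only if c were
a.e. constant. Choosing θ gives strict Cauchy–Schwarz for consecutive moments. -/
theorem moment_quadratic_pos (hc : AEMeasurable c μ) (h0 : ∀ᵐ ω ∂μ, 0 ≤ c ω)
    (hn : ¬ ∃ r : ℝ, ∀ᵐ ω ∂μ, c ω = r) {x : ℝ} (hx : 0 < x) (i : ℕ) (θ : ℝ) :
    0 < invMoment μ c (i + 2) x - 2 * θ * invMoment μ c (i + 1) x + θ ^ 2 * invMoment μ c i x := by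
  obtain ⟨hI, he⟩ := integral_inv_pow_mul_sq hc h0 hx i θ
  rw [← he]
  have hp : ∀ᵐ ω ∂μ, 0 ≤ ((c ω + x)⁻¹) ^ i * ((c ω + x)⁻¹ - θ) ^ 2 := by
    filter_upwards [h0] with ω hω
    positivity
  refine lt_of_le_of_ne (integral_nonneg_of_ae hp) fun h => hn ⟨θ⁻¹ - x, ?_⟩
  have h2 := (integral_eq_zero_iff_of_nonneg_ae hp hI).1 h.symm
  filter_upwards [h2, h0] with ω h3 hω
  have h4 : ((c ω + x)⁻¹) ^ i ≠ 0 := by positivity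
  simp only [Pi.zero_apply, mul_eq_zero, h4, false_or] at h3
  have h5 : (c ω + x)⁻¹ = θ := by nlinarith [pow_eq_zero_iff (two_ne_zero) |>.1 h3]
  rw [← h5, inv_inv]; ring

theorem sq_invMoment_one_lt (hc : AEMeasurable c μ) (h0 : ∀ᵐ ω ∂μ, 0 ≤ c ω)
    (hn : ¬ ∃ r : ℝ, ∀ᵐ ω ∂μ, c ω = r) {x : ℝ} (hx : 0 < x) :
    invMoment μ c 1 x ^ 2 < invMoment μ c 2 x := by
  have := moment_quadratic_pos hc h0 hn hx 0 (invMoment μ c 1 x)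
  simp only [zero_add, invMoment_zero] at this
  nlinarith

theorem sq_invMoment_two_lt (hc : AEMeasurable c μ) (h0 : ∀ᵐ ω ∂μ, 0 ≤ c ω)
    (hn : ¬ ∃ r : ℝ, ∀ᵐ ω ∂μ, c ω = r) {x : ℝ} (hx : 0 < x) :
    invMoment μ c 2 x ^ 2 < invMoment μ c 1 x * invMoment μ c 3 x := by
  have hp := invMoment_pos hc h0 hx 1
  -- This θ minimises the quadratic, so its positivity is the discriminant inequality.
  have := moment_quadratic_pos hc h0 hn hx 1 (invMoment μ c 2 x / invMoment μ c 1 x)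
  simp only [Nat.reduceAdd] at this
  have h2 := mul_pos hp this
  field_simp at h2
  nlinarith

/-- With Y = (c + x)⁻¹, the bound xY ≤ 1 gives x ∫ Y(Y - G₁)² ≤ ∫ (Y - G₁)². Multiplied by G₁, the
left side is the stated one plus x(G₂ - G₁²)², which is dropped. -/
theorem invMoment_gap_le (hc : AEMeasurable c μ) (h0 : ∀ᵐ ω ∂μ, 0 ≤ c ω) {x : ℝ} (hx : 0 < x) :
    x * (invMoment μ c 1 x * invMoment μ c 3 x - invMoment μ c 2 x ^ 2) ≤
      invMoment μ c 1 x * (invMoment μ c 2 x - invMoment μ c 1 x ^ 2) := by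
  have hp := invMoment_pos hc h0 hx 1
  obtain ⟨i1, e1⟩ := integral_inv_pow_mul_sq hc h0 hx 1 (invMoment μ c 1 x)
  obtain ⟨i0, e0⟩ := integral_inv_pow_mul_sq hc h0 hx 0 (invMoment μ c 1 x)
  have hle := integral_mono_ae (i1.const_mul x) i0 (by
    filter_upwards [h0] with ω hω
    have h1 : x * (c ω + x)⁻¹ ≤ 1 := by
      rw [← div_eq_mul_inv, div_le_one (by linarith)]; linarith
    have := mul_le_mul_of_nonneg_right h1 (sq_nonneg ((c ω + x)⁻¹ - invMoment μ c 1 x))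
    simpa [mul_assoc] using this)
  rw [integral_const_mul, e1, e0] at hle
  simp only [zero_add, Nat.reduceAdd, invMoment_zero] at hle
  nlinarith [mul_le_mul_of_nonneg_left hle hp.le,
    mul_nonneg hx.le (sq_nonneg (invMoment μ c 2 x - invMoment μ c 1 x ^ 2))]

theorem hasDerivAt_harmonicShift (hc : AEMeasurable c μ) (h0 : ∀ᵐ ω ∂μ, 0 ≤ c ω) {x : ℝ}
    (hx : 0 < x) :
    HasDerivAt (harmonicShift μ c) (invMoment μ c 2 x / invMoment μ c 1 x ^ 2 - 1) x := by
  have h := ((hasDerivAt_invMoment hc h0 hx 1).inv (invMoment_pos hc h0 hx 1).ne').sub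
    (hasDerivAt_id x)
  refine h.congr_deriv ?_
  simp

theorem hasDerivAt_stationaryShift (hc : AEMeasurable c μ) (h0 : ∀ᵐ ω ∂μ, 0 ≤ c ω) {x : ℝ}
    (hx : 0 < x) :
    HasDerivAt (stationaryShift μ c) (2 * (invMoment μ c 1 x * invMoment μ c 3 x -
      invMoment μ c 2 x ^ 2) / invMoment μ c 2 x ^ 2) x := by
  have hp := invMoment_pos hc h0 hx 2
  have h := ((hasDerivAt_invMoment hc h0 hx 1).div (hasDerivAt_invMoment hc h0 hx 2) hp.ne').sub
    (hasDerivAt_id x)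
  refine h.congr_deriv ?_
  simp only [Nat.reduceAdd]
  field_simp
  push_cast
  ring

theorem hasDerivAt_interiorProportion (hc : AEMeasurable c μ) (h0 : ∀ᵐ ω ∂μ, 0 ≤ c ω) (n : ℝ)
    {x : ℝ} (hx : 0 < x) :
    HasDerivAt (interiorProportion μ c n)
      (invMoment μ c 2 x * (n - stationaryShift μ c x)) x := by
  have hp := invMoment_pos hc h0 hx 2
  have h := (((hasDerivAt_id x).add_const n).mul (hasDerivAt_invMoment hc h0 hx 1)).const_sub 1
  refine h.congr_deriv ?_
  simp only [stationaryShift, id]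
  field_simp
  push_cast
  ring

theorem strictMonoOn_harmonicShift (hc : AEMeasurable c μ) (h0 : ∀ᵐ ω ∂μ, 0 ≤ c ω)
    (hn : ¬ ∃ r : ℝ, ∀ᵐ ω ∂μ, c ω = r) : StrictMonoOn (harmonicShift μ c) (Set.Ioi 0) := by
  refine strictMonoOn_of_deriv_pos (convex_Ioi 0)
    (fun x hx => (hasDerivAt_harmonicShift hc h0 hx).continuousAt.continuousWithinAt) ?_
  intro x hx
  rw [interior_Ioi] at hx
  rw [(hasDerivAt_harmonicShift hc h0 hx).deriv, sub_pos,
    one_lt_div (pow_pos (invMoment_pos hc h0 hx 1) 2)]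
  exact sq_invMoment_one_lt hc h0 hn hx

theorem stationaryShift_deriv_pos (hc : AEMeasurable c μ) (h0 : ∀ᵐ ω ∂μ, 0 ≤ c ω)
    (hn : ¬ ∃ r : ℝ, ∀ᵐ ω ∂μ, c ω = r) {x : ℝ} (hx : 0 < x) :
    0 < 2 * (invMoment μ c 1 x * invMoment μ c 3 x - invMoment μ c 2 x ^ 2) /
      invMoment μ c 2 x ^ 2 := by
  have := sq_invMoment_two_lt hc h0 hn hx
  have := invMoment_pos hc h0 hx 2
  apply div_pos <;> nlinarith

theorem strictMonoOn_stationaryShift (hc : AEMeasurable c μ) (h0 : ∀ᵐ ω ∂μ, 0 ≤ c ω)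
    (hn : ¬ ∃ r : ℝ, ∀ᵐ ω ∂μ, c ω = r) : StrictMonoOn (stationaryShift μ c) (Set.Ioi 0) := by
  refine strictMonoOn_of_deriv_pos (convex_Ioi 0)
    (fun x hx => (hasDerivAt_stationaryShift hc h0 hx).continuousAt.continuousWithinAt) ?_
  intro x hx
  rw [interior_Ioi] at hx
  rw [(hasDerivAt_stationaryShift hc h0 hx).deriv]
  exact stationaryShift_deriv_pos hc h0 hn hx

theorem stationaryShift_lt_harmonicShift (hc : AEMeasurable c μ) (h0 : ∀ᵐ ω ∂μ, 0 ≤ c ω)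
    (hn : ¬ ∃ r : ℝ, ∀ᵐ ω ∂μ, c ω = r) {x : ℝ} (hx : 0 < x) :
    stationaryShift μ c x < harmonicShift μ c x := by
  have h1 := invMoment_pos hc h0 hx 1
  have h2 := invMoment_pos hc h0 hx 2
  unfold stationaryShift harmonicShift
  gcongr
  rw [div_lt_iff₀ h2, inv_mul_eq_div, lt_div_iff₀ h1, ← sq]
  exact sq_invMoment_one_lt hc h0 hn hx

theorem mul_invMoment_one_le (hc : AEMeasurable c μ) (h0 : ∀ᵐ ω ∂μ, 0 ≤ c ω) {x : ℝ}
    (hx : 0 < x) : x * invMoment μ c 1 x ≤ 1 := by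
  have := integral_mono_ae ((integrable_inv_pow hc h0 hx 1).const_mul x)
    (integrable_const (1 : ℝ)) (by
    filter_upwards [h0] with ω hω
    rw [pow_one, ← div_eq_mul_inv, div_le_one (by linarith)]; linarith)
  rw [integral_const_mul] at this
  simpa [invMoment] using this

theorem harmonicShift_nonneg (hc : AEMeasurable c μ) (h0 : ∀ᵐ ω ∂μ, 0 ≤ c ω) {x : ℝ}
    (hx : 0 < x) : 0 ≤ harmonicShift μ c x := by
  have h1 := invMoment_pos hc h0 hx 1
  have h2 := mul_invMoment_one_le hc h0 hx
  rw [harmonicShift, sub_nonneg, ← one_div, le_div_iff₀ h1]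
  exact h2

/-- Dominated convergence: x/(c + x) lies in [0, 1] and tends to 1, with no integrability of c
needed. -/
theorem tendsto_mul_invMoment_one (hc : AEMeasurable c μ) (h0 : ∀ᵐ ω ∂μ, 0 ≤ c ω) :
    Tendsto (fun x => x * invMoment μ c 1 x) atTop (𝓝 1) := by
  have key : Tendsto (fun x : ℝ => ∫ ω, x * (c ω + x)⁻¹ ∂μ) atTop (𝓝 (∫ _, (1 : ℝ) ∂μ)) := by
    refine tendsto_integral_filter_of_dominated_convergence (fun _ => 1)
      (Eventually.of_forall fun x => ((hc.add_const x).inv.const_mul x).aestronglyMeasurable)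
      ?_ (integrable_const _) (Eventually.of_forall fun ω => ?_)
    · filter_upwards [eventually_gt_atTop 0] with x hx
      filter_upwards [h0] with ω hω
      have h1 : 0 < c ω + x := by linarith
      rw [Real.norm_of_nonneg (by positivity), ← div_eq_mul_inv, div_le_one h1]
      linarith
    · have h1 : Tendsto (fun x : ℝ => 1 - c ω * (c ω + x)⁻¹) atTop (𝓝 (1 - c ω * 0)) :=
        ((tendsto_inv_atTop_zero.comp
          (tendsto_atTop_add_const_left _ (c ω) tendsto_id)).const_mul (c ω)).const_sub 1
      rw [mul_zero, sub_zero] at h1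
      refine h1.congr' ?_
      filter_upwards [eventually_gt_atTop (-c ω)] with x hx
      have : c ω + x ≠ 0 := by linarith
      field_simp
      ring
  simpa [integral_const_mul, invMoment] using key

end Moments

/-! ### Extended integrals and essential infima under translation. -/

section ExtIntegral

variable {μ : Measure Ω}

theorem extIntegral_mono {f g : Ω → ℝ} (h : f ≤ᵐ[μ] g) : extIntegral μ f ≤ extIntegral μ g := by
  refine EReal.sub_le_sub ?_ ?_ <;> rw [EReal.coe_ennreal_le_coe_ennreal_iff]
  · exact lintegral_mono_ae (h.mono fun x hx => ENNReal.ofReal_le_ofReal hx)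
  · exact lintegral_mono_ae (h.mono fun x hx => ENNReal.ofReal_le_ofReal (neg_le_neg hx))

theorem extIntegral_of_integrable {f : Ω → ℝ} (h : Integrable f μ) :
    extIntegral μ f = ((∫ x, f x ∂μ : ℝ) : EReal) := by
  rw [integral_eq_lintegral_pos_part_sub_lintegral_neg_part h, extIntegral, EReal.coe_sub]
  congr 1
  · exact (EReal.coe_ennreal_toReal h.lintegral_lt_top.ne).symm
  · exact (EReal.coe_ennreal_toReal h.neg.lintegral_lt_top.ne).symm

variable [IsProbabilityMeasure μ]

theorem extIntegral_eq_top {f : Ω → ℝ} (hf : AEMeasurable f μ) {B : ℝ} (hB : ∀ᵐ x ∂μ, B ≤ f x)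
    (h : ¬ Integrable f μ) : extIntegral μ f = ⊤ := by
  have hneg : ∫⁻ x, ENNReal.ofReal (-f x) ∂μ ≠ ⊤ := by
    have : ∫⁻ x, ENNReal.ofReal (-f x) ∂μ ≤ ∫⁻ _, ENNReal.ofReal (-B) ∂μ :=
      lintegral_mono_ae (hB.mono fun x hx => ENNReal.ofReal_le_ofReal (neg_le_neg hx))
    refine (this.trans_lt ?_).ne
    simp
  have hpos : ∫⁻ x, ENNReal.ofReal (f x) ∂μ = ⊤ := by
    by_contra hp
    refine h ((integrable_const B).add (g := fun x => f x - B) ?_ |>.congr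
      (Eventually.of_forall fun x => by simp))
    refine ⟨(hf.sub_const B).aestronglyMeasurable, ?_⟩
    rw [hasFiniteIntegral_iff_ofReal (hB.mono fun x hx => sub_nonneg.2 hx)]
    calc ∫⁻ x, ENNReal.ofReal (f x - B) ∂μ
        ≤ ∫⁻ x, (ENNReal.ofReal (f x) + ENNReal.ofReal (-B)) ∂μ :=
          lintegral_mono fun x => by rw [sub_eq_add_neg]; exact ENNReal.ofReal_add_le
      _ = ∫⁻ x, ENNReal.ofReal (f x) ∂μ + ENNReal.ofReal (-B) := by
          rw [lintegral_add_right _ measurable_const]; simp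
      _ < ⊤ := ENNReal.add_lt_top.2 ⟨lt_top_iff_ne_top.2 hp, ENNReal.ofReal_lt_top⟩
  lift ∫⁻ x, ENNReal.ofReal (-f x) ∂μ to NNReal using hneg with r hr
  rw [extIntegral, hpos, ← hr]
  exact EReal.top_sub_coe _

theorem extIntegral_sub_const {f : Ω → ℝ} (hf : AEMeasurable f μ) {B : ℝ}
    (hB : ∀ᵐ x ∂μ, B ≤ f x) (r : ℝ) :
    extIntegral μ (fun x => f x - r) = extIntegral μ f - (r : EReal) := by
  by_cases h : Integrable f μ
  · have h' : Integrable (fun x => f x - r) μ := h.sub (integrable_const r)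
    rw [extIntegral_of_integrable h, extIntegral_of_integrable h', ← EReal.coe_sub,
      integral_sub h (integrable_const r)]
    simp
  · rw [extIntegral_eq_top hf hB h, EReal.top_sub_coe]
    refine extIntegral_eq_top (B := B - r) (hf.sub_const r) (hB.mono fun x hx => by linarith) ?_
    intro h'
    exact h ((h'.add (integrable_const r)).congr (Eventually.of_forall fun x => by simp))

theorem essInf_sub_const {f : Ω → ℝ} {B : ℝ} (hB : ∀ᵐ x ∂μ, B ≤ f x) (r : ℝ) :
    essInf (fun x => f x - r) μ = essInf f μ - r := by
  have hco : IsCoboundedUnder (· ≥ ·) (ae μ) f := by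
    -- Otherwise f would exceed every natural number at a single point.
    obtain ⟨K, hK⟩ : ∃ K : ℝ, ∃ᶠ x in ae μ, f x ≤ K := by
      by_contra! hcon
      have h1 : ∀ᵐ x ∂μ, ∀ K : ℕ, (K : ℝ) < f x := by
        rw [ae_all_iff]
        exact fun K => hcon K
      obtain ⟨x, hx⟩ := h1.exists
      obtain ⟨K, hK⟩ := exists_nat_gt (f x)
      exact lt_asymm hK (hx K)
    exact IsCoboundedUnder.of_frequently_le hK
  have hbd : IsBoundedUnder (· ≥ ·) (ae μ) f := isBoundedUnder_of_eventually_ge hB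
  exact ((OrderIso.subRight r).liminf_apply hbd hco
    (isBoundedUnder_of_eventually_ge (a := B - r) (hB.mono fun x hx => by simpa using hx))
    (by
      obtain ⟨b, hb⟩ := hco
      refine ⟨b - r, fun y hy => ?_⟩
      have := hb (y + r) (by
        simp only [eventually_map] at hy ⊢
        filter_upwards [hy] with x hx
        simp only [OrderIso.subRight_apply, ge_iff_le] at hx ⊢
        linarith)
      simp only [ge_iff_le] at this ⊢
      linarith)).symm

end ExtIntegral

/-! ### Both shifts compared with the mean of c, finite or infinite. -/

section Limits

variable {μ : Measure Ω} [IsProbabilityMeasure μ] {c : Ω → ℝ}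

theorem stationaryShift_nonneg (hc : AEMeasurable c μ) (h0 : ∀ᵐ ω ∂μ, 0 ≤ c ω) {x : ℝ}
    (hx : 0 < x) : 0 ≤ stationaryShift μ c x := by
  have h3 := invMoment_pos hc h0 hx 2
  rw [stationaryShift, sub_nonneg, le_div_iff₀ h3]
  have := integral_mono_ae ((integrable_inv_pow hc h0 hx 2).const_mul x)
    (integrable_inv_pow hc h0 hx 1) (by
      filter_upwards [h0] with ω hω
      have h1 : 0 < c ω + x := by linarith
      have h2 : x * (c ω + x)⁻¹ ≤ 1 := by
        rw [← div_eq_mul_inv, div_le_one h1]; linarith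
      have := mul_le_mul_of_nonneg_right h2 (inv_pos.2 h1).le
      rw [one_mul] at this
      rw [pow_one, sq, ← mul_assoc]
      exact this)
  rw [integral_const_mul] at this
  exact this

/-- Since ∫ c (c + x)⁻² = G₂ M and x² G₂ ≤ 1, a bound M ≤ e gives ∫ c x²/(c + x)² ≤ e for all x.
Fatou's lemma as x → ∞ then gives ∫ c ≤ e. -/
theorem exists_lt_stationaryShift (hc : AEMeasurable c μ) (h0 : ∀ᵐ ω ∂μ, 0 ≤ c ω) {e : ℝ}
    (he : (e : EReal) < extIntegral μ c) : ∃ x : ℝ, 0 < x ∧ e < stationaryShift μ c x := by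
  by_contra! hcon
  refine not_le.2 he ?_
  have hlin : ∀ x : ℝ, 0 < x →
      Integrable (fun ω => x ^ 2 * (c ω * ((c ω + x)⁻¹) ^ 2)) μ ∧
      ∫ ω, x ^ 2 * (c ω * ((c ω + x)⁻¹) ^ 2) ∂μ =
        x ^ 2 * (invMoment μ c 1 x - x * invMoment μ c 2 x) := by
    intro x hx
    have e1 : (fun ω => x ^ 2 * (c ω * ((c ω + x)⁻¹) ^ 2)) =ᵐ[μ]
        fun ω => x ^ 2 * (((c ω + x)⁻¹) ^ 1 - x * ((c ω + x)⁻¹) ^ 2) := by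
      filter_upwards [h0] with ω hω
      have : c ω + x ≠ 0 := by linarith
      field_simp
      ring
    have i1 := integrable_inv_pow hc h0 hx 1
    have i2 := (integrable_inv_pow hc h0 hx 2).const_mul x
    refine ⟨((i1.sub i2).const_mul (x ^ 2)).congr e1.symm, ?_⟩
    rw [integral_congr_ae e1, integral_const_mul, integral_sub i1 i2, integral_const_mul]
    rfl
  have hx2 : ∀ x : ℝ, 0 < x → x ^ 2 * invMoment μ c 2 x ≤ 1 := by
    intro x hx
    have := integral_mono_ae ((integrable_inv_pow hc h0 hx 2).const_mul (x ^ 2))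
      (integrable_const (1 : ℝ)) (by
      filter_upwards [h0] with ω hω
      have h1 : 0 < c ω + x := by linarith
      rw [← mul_pow]
      refine pow_le_one₀ (by positivity) ?_
      rw [← div_eq_mul_inv, div_le_one h1]; linarith)
    rw [integral_const_mul] at this
    simpa [invMoment] using this
  have hle : ∀ x : ℝ, 0 < x →
      ∫⁻ ω, ENNReal.ofReal (x ^ 2 * (c ω * ((c ω + x)⁻¹) ^ 2)) ∂μ ≤ ENNReal.ofReal e := by
    intro x hx
    have hnn : ∀ᵐ ω ∂μ, 0 ≤ x ^ 2 * (c ω * ((c ω + x)⁻¹) ^ 2) := by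
      filter_upwards [h0] with ω hω
      positivity
    rw [← ofReal_integral_eq_lintegral_ofReal (hlin x hx).1 hnn]
    refine ENNReal.ofReal_le_ofReal ?_
    have h2 := hcon x hx
    have h3 := invMoment_pos hc h0 hx 2
    have h4 : invMoment μ c 1 x - x * invMoment μ c 2 x =
        invMoment μ c 2 x * stationaryShift μ c x := by
      rw [stationaryShift]; field_simp
    have h5 := stationaryShift_nonneg hc h0 hx
    rw [(hlin x hx).2, h4]
    nlinarith [hx2 x hx]
  have hfat : ∫⁻ ω, ENNReal.ofReal (c ω) ∂μ ≤ ENNReal.ofReal e := by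
    let f : ℕ → Ω → ENNReal := fun N ω =>
      ENNReal.ofReal (((N : ℝ) + 1) ^ 2 * (c ω * ((c ω + ((N : ℝ) + 1))⁻¹) ^ 2))
    have hlim : ∀ ω, liminf (fun N => f N ω) atTop = ENNReal.ofReal (c ω) := by
      intro ω
      refine Tendsto.liminf_eq (ENNReal.tendsto_ofReal ?_)
      have hN : Tendsto (fun N : ℕ => (N : ℝ) + 1) atTop atTop :=
        tendsto_atTop_add_const_right _ _ tendsto_natCast_atTop_atTop
      have h1 : Tendsto (fun x : ℝ => c ω * (1 - c ω * (c ω + x)⁻¹) ^ 2) atTop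
          (𝓝 (c ω * (1 - c ω * 0) ^ 2)) :=
        ((((tendsto_inv_atTop_zero.comp (tendsto_atTop_add_const_left _ (c ω) tendsto_id)).const_mul
          (c ω)).const_sub 1).pow 2).const_mul (c ω)
      rw [mul_zero, sub_zero, one_pow, mul_one] at h1
      refine (h1.comp hN).congr' ?_
      filter_upwards [hN.eventually (eventually_gt_atTop (-c ω))] with N hN
      have : c ω + ((N : ℝ) + 1) ≠ 0 := by linarith
      simp only [Function.comp]
      field_simp
      ring
    calc ∫⁻ ω, ENNReal.ofReal (c ω) ∂μ = ∫⁻ ω, liminf (fun N => f N ω) atTop ∂μ := by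
          simp_rw [hlim]
      _ ≤ liminf (fun N => ∫⁻ ω, f N ω ∂μ) atTop := by
          refine lintegral_liminf_le' fun N => ?_
          exact ((hc.mul ((hc.add_const _).inv.pow_const 2)).const_mul _).ennreal_ofReal
      _ ≤ ENNReal.ofReal e := by
          refine liminf_le_of_le (by isBoundedDefault) fun b hb => ?_
          obtain ⟨N, hN⟩ := hb.exists
          exact hN.trans (hle _ (by positivity))
  have he0 : 0 ≤ e := (stationaryShift_nonneg hc h0 one_pos).trans (hcon 1 one_pos)
  have hneg : ∫⁻ ω, ENNReal.ofReal (-c ω) ∂μ = 0 := by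
    rw [← lintegral_zero (μ := μ)]
    refine lintegral_congr_ae ?_
    filter_upwards [h0] with ω hω
    exact ENNReal.ofReal_of_nonpos (by linarith)
  rw [extIntegral, hneg, EReal.coe_ennreal_zero, sub_zero]
  calc ((∫⁻ ω, ENNReal.ofReal (c ω) ∂μ : ENNReal) : EReal) ≤ (ENNReal.ofReal e : EReal) :=
        EReal.coe_ennreal_le_coe_ennreal_iff.2 hfat
    _ = (e : EReal) := by rw [EReal.coe_ennreal_ofReal, max_eq_left he0]

theorem harmonicShift_lt_extIntegral (hc : AEMeasurable c μ) (h0 : ∀ᵐ ω ∂μ, 0 ≤ c ω)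
    (hn : ¬ ∃ r : ℝ, ∀ᵐ ω ∂μ, c ω = r) {x : ℝ} (hx : 0 < x) :
    (harmonicShift μ c x : EReal) < extIntegral μ c := by
  by_cases hi : Integrable c μ
  · rw [extIntegral_of_integrable hi, EReal.coe_lt_coe_iff]
    -- Moving to x + 1 supplies the strictness, so the weak harmonic–arithmetic mean inequality
    -- suffices there.
    refine (strictMonoOn_harmonicShift hc h0 hn hx (show (0 : ℝ) < x + 1 by linarith)
      (lt_add_one x)).trans_le ?_
    generalize hy : x + 1 = y
    have hy0 : 0 < y := by linarith
    have h1 := invMoment_pos hc h0 hy0 1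
    set θ := (invMoment μ c 1 y)⁻¹ with hθ
    have i1 := (integrable_inv_pow hc h0 hy0 1).const_mul (θ ^ 2)
    have := integral_mono_ae ((integrable_const (2 * θ - y)).sub i1) hi (by
      filter_upwards [h0] with ω hω
      have h2 : 0 < c ω + y := by linarith
      have h3 : 0 ≤ (c ω + y)⁻¹ * (c ω + y - θ) ^ 2 := by positivity
      have h4 : (c ω + y)⁻¹ * (c ω + y - θ) ^ 2 = c ω + y - 2 * θ + θ ^ 2 * (c ω + y)⁻¹ := by
        field_simp
        ring
      simp only [Pi.sub_apply, pow_one]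
      linarith)
    simp only [Pi.sub_apply] at this
    rw [integral_sub (integrable_const _) i1, integral_const_mul] at this
    change _ - θ ^ 2 * invMoment μ c 1 y ≤ _ at this
    have h5 : θ ^ 2 * invMoment μ c 1 y = θ := by
      rw [hθ]; field_simp
    rw [h5] at this
    simp only [integral_const, probReal_univ, one_smul] at this
    rw [harmonicShift]
    linarith
  · rw [extIntegral_eq_top hc h0 hi]
    exact EReal.coe_lt_top _

end Limits

/-! ### The optimal proportion: existence, uniqueness and formula. -/

/-- The parameter `X ≥ 0` belonging to the price `u`: either `X > 0` and the shifted harmonic mean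
at `X` is `n + u`, or `X = 0` and all shifted harmonic means exceed `n + u`. -/
def IsParameter (μ : Measure Ω) (c : Ω → ℝ) (n u X : ℝ) : Prop :=
  (X = 0 ∧ ∀ y, 0 < y → n + u < harmonicShift μ c y) ∨ (0 < X ∧ harmonicShift μ c X = n + u)

section Optimal

theorem ae_payoff_pos {μ : Measure Ω} {c : Ω → ℝ}
    (h0 : ∀ᵐ ω ∂μ, 0 ≤ c ω) {n u s : ℝ} (hn : 0 < n) (hu : 0 < u)
    (hs : s ∈ Set.Ico 0 (u / (u + n))) : ∀ᵐ ω ∂μ, 0 < (c ω - n) * s / u - s + 1 := by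
  obtain ⟨h1, h2⟩ := hs
  rw [lt_div_iff₀ (by linarith)] at h2
  filter_upwards [h0] with ω hω
  have h3 : (c ω - n) * s / u - s + 1 = (c ω * s + (u - s * (u + n))) / u := by
    field_simp
    ring
  rw [h3]
  have : 0 ≤ c ω * s := by positivity
  exact div_pos (by linarith) hu

theorem parameter_pos_of_lt {n u ρ : ℝ} (hn : 0 < n) (hu : 0 < u)
    (hρ : ρ ∈ Set.Ioo 0 (u / (u + n))) : 0 < u / ρ - u - n := by
  have h1 : u + n < u / ρ := (lt_div_comm₀ hρ.1 (by linarith)).1 hρ.2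
  linarith

variable {μ : Measure Ω} [IsProbabilityMeasure μ] {c : Ω → ℝ}

theorem admissible_translate (hξ : essInf c μ = 0) {n u : ℝ} (h0 : ∀ᵐ ω ∂μ, 0 ≤ c ω)
    (hn : 0 < n) (hu : 0 < u) :
    admissible μ (fun ω => c ω - n) u = Set.Ico 0 (u / (u + n)) := by
  have h1 : 0 < u + n := by linarith
  ext s
  rw [admissible, essInf_sub_const h0, hξ, Set.mem_ofPred_eq, Set.mem_Ico, lt_div_iff₀ h1]
  have h2 : (0 - n) * s / u - s + 1 = (u - s * (u + n)) / u := by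
    field_simp
    ring
  rw [h2]
  constructor
  · rintro ⟨h3, -, h5⟩
    refine ⟨h3, ?_⟩
    have := (div_pos_iff_of_pos_right hu).1 h5
    linarith
  · rintro ⟨h3, h4⟩
    refine ⟨h3, ?_, div_pos (by linarith) hu⟩
    nlinarith

/-- The integral of the linear part of the logarithmic gain. -/
noncomputable def linearGain (μ : Measure Ω) (c : Ω → ℝ) (n u s ρ : ℝ) : ℝ :=
  (s - ρ) / ρ * invMoment μ c 1 (u / ρ - u - n) * (harmonicShift μ c (u / ρ - u - n) - n - u)

/-- In the parameter x = u/ρ - u - n the payoff at ρ is (ρ/u)(c + x), so the payoff ratio is affine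
in (c + x)⁻¹ and only G₁ enters. -/
theorem integral_linearGain (hc : AEMeasurable c μ) (h0 : ∀ᵐ ω ∂μ, 0 ≤ c ω) {n u s ρ : ℝ}
    (hu : 0 < u) (hρ : 0 < ρ) (hx : 0 < u / ρ - u - n) :
    Integrable (fun ω => ((c ω - n) * s / u - s + 1) / ((c ω - n) * ρ / u - ρ + 1) - 1) μ ∧
    ∫ ω, (((c ω - n) * s / u - s + 1) / ((c ω - n) * ρ / u - ρ + 1) - 1) ∂μ =
      linearGain μ c n u s ρ := by
  have hp := invMoment_pos hc h0 hx 1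
  set x := u / ρ - u - n with hxdef
  have e1 : (fun ω => ((c ω - n) * s / u - s + 1) / ((c ω - n) * ρ / u - ρ + 1) - 1) =ᵐ[μ]
      fun ω => (s - ρ) / ρ * (1 - u / ρ * ((c ω + x)⁻¹) ^ 1) := by
    filter_upwards [h0] with ω hω
    have h1 : 0 < c ω + x := by linarith
    have h2 : (c ω - n) * ρ / u - ρ + 1 = ρ / u * (c ω + x) := by
      rw [hxdef]; field_simp; ring
    have h3 : (c ω - n) * s / u - s + 1 = ρ / u * (c ω + x) + (s - ρ) / u * (c ω + x - u / ρ) := by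
      rw [hxdef]; field_simp; ring
    rw [h2, h3]
    field_simp
    ring
  have i1 := (integrable_inv_pow hc h0 hx 1).const_mul (u / ρ)
  have i2 := ((integrable_const (1 : ℝ)).sub i1).const_mul ((s - ρ) / ρ)
  refine ⟨i2.congr e1.symm, ?_⟩
  rw [integral_congr_ae e1, integral_const_mul, integral_sub (integrable_const _) i1,
    integral_const_mul, linearGain, ← hxdef, mul_assoc]
  congr 1
  change _ - u / ρ * invMoment μ c 1 x = _
  have h4 : u / ρ = x + n + u := by rw [hxdef]; ring
  rw [h4, harmonicShift]
  simp only [integral_const, probReal_univ, one_smul]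
  field_simp
  ring

theorem extIntegral_log_le (hc : AEMeasurable c μ) (h0 : ∀ᵐ ω ∂μ, 0 ≤ c ω) {n u s ρ : ℝ}
    (hn : 0 < n) (hu : 0 < u) (hs : s ∈ Set.Ico 0 (u / (u + n)))
    (hρ : ρ ∈ Set.Ioo 0 (u / (u + n))) (hx : 0 < u / ρ - u - n) :
    extIntegral μ (fun ω => Real.log (((c ω - n) * s / u - s + 1) /
      ((c ω - n) * ρ / u - ρ + 1))) ≤ ((linearGain μ c n u s ρ : ℝ) : EReal) := by
  obtain ⟨hi, he⟩ := integral_linearGain (s := s) hc h0 hu hρ.1 hx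
  rw [← he, ← extIntegral_of_integrable hi]
  refine extIntegral_mono ?_
  filter_upwards [ae_payoff_pos h0 hn hu hs, ae_payoff_pos h0 hn hu ⟨hρ.1.le, hρ.2⟩] with ω h1 h2
  exact Real.log_le_sub_one_of_pos (div_pos h1 h2)

/-- The inequality log r ≤ r - 1 applied to the inverse ratio, so the linearisation is at s. -/
theorem le_extIntegral_log (hc : AEMeasurable c μ) (h0 : ∀ᵐ ω ∂μ, 0 ≤ c ω) {n u s ρ : ℝ}
    (hn : 0 < n) (hu : 0 < u) (hs : s ∈ Set.Ioo 0 (u / (u + n)))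
    (hρ : ρ ∈ Set.Ico 0 (u / (u + n))) (hx : 0 < u / s - u - n) :
    ((-linearGain μ c n u ρ s : ℝ) : EReal) ≤
    extIntegral μ (fun ω => Real.log (((c ω - n) * s / u - s + 1) /
      ((c ω - n) * ρ / u - ρ + 1))) := by
  obtain ⟨hi, he⟩ := integral_linearGain (s := ρ) hc h0 hu hs.1 hx
  have hneg := extIntegral_of_integrable hi.neg
  simp only [Pi.neg_apply, integral_neg, he] at hneg
  rw [← hneg]
  refine extIntegral_mono ?_
  filter_upwards [ae_payoff_pos h0 hn hu hρ, ae_payoff_pos h0 hn hu ⟨hs.1.le, hs.2⟩] with ω h1 h2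
  have := Real.log_le_sub_one_of_pos (div_pos h1 h2)
  rw [← inv_div, Real.log_inv]
  simp only [Pi.neg_apply]
  linarith

/-- The linear gain bounds the logarithmic one. If X > 0 it tends to 0 as ρ approaches the
candidate; if X = 0 it is already nonpositive near the candidate. -/
theorem isOptimalProportion_of_isParameter (hc : AEMeasurable c μ) (h0 : ∀ᵐ ω ∂μ, 0 ≤ c ω)
    (hξ : essInf c μ = 0) {n u X : ℝ} (hn : 0 < n) (hu : 0 < u) (hX : IsParameter μ c n u X) :
    IsOptimalProportion μ (fun ω => c ω - n) u (u / (X + n + u)) := by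
  have hX0 : 0 ≤ X := by
    rcases hX with h | h
    · exact h.1.ge
    · exact h.1.le
  have hT : 0 < u / (u + n) := by positivity
  have ht : 0 < u / (X + n + u) := by positivity
  have hmem : u / (X + n + u) ∈ closure (Set.Ico 0 (u / (u + n))) := by
    rw [closure_Ico hT.ne]
    refine ⟨ht.le, ?_⟩
    exact div_le_div_of_nonneg_left hu.le (by linarith) (by linarith)
  rw [IsOptimalProportion, admissible_translate hξ h0 hn hu]
  refine ⟨hmem, fun s hs => ?_⟩
  have hne : (𝓝[Set.Ico 0 (u / (u + n))] (u / (X + n + u))).NeBot :=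
    mem_closure_iff_nhdsWithin_neBot.1 hmem
  have hev : ∀ᶠ ρ in 𝓝[Set.Ico 0 (u / (u + n))] (u / (X + n + u)),
      ρ ∈ Set.Ioo 0 (u / (u + n)) := by
    filter_upwards [self_mem_nhdsWithin, nhdsWithin_le_nhds (lt_mem_nhds ht)] with ρ h1 h2
    exact ⟨h2, h1.2⟩
  have hle : ∀ᶠ ρ in 𝓝[Set.Ico 0 (u / (u + n))] (u / (X + n + u)),
      extIntegral μ (fun ω => Real.log (((c ω - n) * s / u - s + 1) /
        ((c ω - n) * ρ / u - ρ + 1))) ≤ ((linearGain μ c n u s ρ : ℝ) : EReal) := by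
    filter_upwards [hev] with ρ hρ
    exact extIntegral_log_le hc h0 hn hu hs hρ (parameter_pos_of_lt hn hu hρ)
  rcases hX with ⟨rfl, hb⟩ | ⟨hXpos, hk⟩
  · refine limsup_le_of_le (by isBoundedDefault) ?_
    -- For X = 0 the candidate is the excluded right endpoint, so every admissible s lies strictly
    -- below it.
    have hst : s < u / (0 + n + u) := by
      have := hs.2
      rwa [zero_add, add_comm n u]
    filter_upwards [hle, hev, nhdsWithin_le_nhds (lt_mem_nhds hst)] with ρ h1 h2 h3
    refine h1.trans ?_
    have hx := parameter_pos_of_lt hn hu h2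
    rw [← EReal.coe_zero, EReal.coe_le_coe_iff, linearGain]
    refine mul_nonpos_of_nonpos_of_nonneg (mul_nonpos_of_nonpos_of_nonneg ?_
      (invMoment_pos hc h0 hx 1).le) (by linarith [hb _ hx])
    exact div_nonpos_of_nonpos_of_nonneg (by linarith) h2.1.le
  · have hxt : u / (u / (X + n + u)) - u - n = X := by
      rw [div_div_cancel₀ hu.ne']; ring
    have hlim : Tendsto (linearGain μ c n u s) (𝓝 (u / (X + n + u))) (𝓝 0) := by
      have hinner : ContinuousAt (fun ρ : ℝ => u / ρ - u - n) (u / (X + n + u)) :=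
        ((continuousAt_const.div continuousAt_id ht.ne').sub continuousAt_const).sub
          continuousAt_const
      have hG : ContinuousAt (fun ρ => invMoment μ c 1 (u / ρ - u - n)) (u / (X + n + u)) := by
        refine ContinuousAt.comp (g := invMoment μ c 1) ?_ hinner
        rw [hxt]
        exact (hasDerivAt_invMoment hc h0 hXpos 1).continuousAt
      have hK : ContinuousAt (fun ρ => harmonicShift μ c (u / ρ - u - n)) (u / (X + n + u)) := by
        refine ContinuousAt.comp (g := harmonicShift μ c) ?_ hinner
        rw [hxt]
        exact (hasDerivAt_harmonicShift hc h0 hXpos).continuousAt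
      have hcont : ContinuousAt (linearGain μ c n u s) (u / (X + n + u)) :=
        (((continuousAt_const.sub continuousAt_id).div continuousAt_id ht.ne').mul hG).mul
          ((hK.sub continuousAt_const).sub continuousAt_const)
      have hval : linearGain μ c n u s (u / (X + n + u)) = 0 := by
        rw [linearGain, hxt, hk]; ring
      rw [← hval]
      exact hcont
    have hlim' := (continuous_coe_real_ereal.tendsto 0).comp
      (hlim.mono_left (nhdsWithin_le_nhds (s := Set.Ico 0 (u / (u + n)))))
    have h3 := hlim'.limsup_eq
    rw [EReal.coe_zero] at h3
    rw [← h3]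
    exact limsup_le_limsup hle

theorem eq_of_isOptimalProportion (hc : AEMeasurable c μ) (h0 : ∀ᵐ ω ∂μ, 0 ≤ c ω)
    (hnc : ¬ ∃ r : ℝ, ∀ᵐ ω ∂μ, c ω = r)
    (hξ : essInf c μ = 0) {n u X t : ℝ} (hn : 0 < n) (hu : 0 < u) (hX : IsParameter μ c n u X)
    (ht : IsOptimalProportion μ (fun ω => c ω - n) u t) : t = u / (X + n + u) := by
  have hX0 : 0 ≤ X := by
    rcases hX with h | h
    · exact h.1.ge
    · exact h.1.le
  have hT : 0 < u / (u + n) := by positivity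
  have hts : 0 < u / (X + n + u) := by positivity
  have htT : u / (X + n + u) ≤ u / (u + n) := by
    exact div_le_div_of_nonneg_left hu.le (by linarith) (by linarith)
  rw [IsOptimalProportion, admissible_translate hξ h0 hn hu] at ht
  obtain ⟨hmem, hopt⟩ := ht
  have hne : (𝓝[Set.Ico 0 (u / (u + n))] t).NeBot := mem_closure_iff_nhdsWithin_neBot.1 hmem
  rw [closure_Ico hT.ne] at hmem
  by_contra hcon
  -- The midpoint of t and the known optimum beats t: at s, the slope of expected log-wealth points
  -- towards the optimum.
  obtain ⟨s, hs, hpos⟩ : ∃ s ∈ Set.Ioo 0 (u / (u + n)), 0 < -linearGain μ c n u t s := by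
    set t' := u / (X + n + u) with ht'
    have hsm : (t + t') / 2 ∈ Set.Ioo 0 (u / (u + n)) := by
      constructor
      · linarith [hmem.1]
      · rcases lt_or_gt_of_ne hcon with h | h
        · linarith
        · linarith [hmem.2]
    refine ⟨(t + t') / 2, hsm, ?_⟩
    set s := (t + t') / 2 with hs
    have hx := parameter_pos_of_lt hn hu hsm
    have hG := invMoment_pos hc h0 hx 1
    have hXt : u / t' - u - n = X := by
      rw [ht', div_div_cancel₀ hu.ne']; ring
    have hrw : -linearGain μ c n u t s = ((s - t) * (harmonicShift μ c (u / s - u - n) - n - u)) *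
        (invMoment μ c 1 (u / s - u - n) / s) := by
      rw [linearGain]; ring
    rw [hrw]
    refine mul_pos ?_ (div_pos hG hsm.1)
    rcases lt_or_gt_of_ne hcon with h | h
    · have hst : s < t' := by linarith
      have hlt : X < u / s - u - n := by
        have : u / t' < u / s := div_lt_div_of_pos_left hu hsm.1 hst
        linarith
      refine mul_pos (by linarith) ?_
      rcases hX with ⟨-, hb⟩ | ⟨hXp, hk⟩
      · linarith [hb _ hx]
      · linarith [strictMonoOn_harmonicShift hc h0 hnc hXp hx hlt]
    · have hst : t' < s := by linarith
      have hlt : u / s - u - n < X := by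
        have : u / s < u / t' := div_lt_div_of_pos_left hu hts hst
        linarith
      refine mul_pos_of_neg_of_neg (by linarith) ?_
      rcases hX with ⟨h1, -⟩ | ⟨hXp, hk⟩
      · linarith
      · linarith [strictMonoOn_harmonicShift hc h0 hnc hx hXp hlt]
  have hcont : Tendsto (fun ρ => -linearGain μ c n u ρ s) (𝓝 t) (𝓝 (-linearGain μ c n u t s)) := by
    have : Continuous (fun ρ => -linearGain μ c n u ρ s) := by
      unfold linearGain
      fun_prop
    exact this.tendsto t
  have hlim := ((continuous_coe_real_ereal.tendsto _).comp
    (hcont.mono_left (nhdsWithin_le_nhds (s := Set.Ico 0 (u / (u + n)))))).limsup_eq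
  have hle := hopt s ⟨hs.1.le, hs.2⟩
  have hge : ((-linearGain μ c n u t s : ℝ) : EReal) ≤ 0 := by
    rw [← hlim]
    refine le_trans (limsup_le_limsup ?_) hle
    filter_upwards [self_mem_nhdsWithin] with ρ hρ
    exact le_extIntegral_log hc h0 hn hu hs hρ (parameter_pos_of_lt hn hu hs)
  exact absurd hge (not_le.2 (EReal.coe_pos.2 hpos))

theorem optimalProportion_eq (hc : AEMeasurable c μ) (h0 : ∀ᵐ ω ∂μ, 0 ≤ c ω)
    (hnc : ¬ ∃ r : ℝ, ∀ᵐ ω ∂μ, c ω = r)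
    (hξ : essInf c μ = 0) {n u X : ℝ} (hn : 0 < n) (hu : 0 < u) (hX : IsParameter μ c n u X) :
    optimalProportion μ (fun ω => c ω - n) u = u / (X + n + u) :=
  eq_of_isOptimalProportion hc h0 hnc hξ hn hu hX
    (Classical.epsilon_spec ⟨_, isOptimalProportion_of_isParameter hc h0 hξ hn hu hX⟩)

theorem exists_isParameter (hc : AEMeasurable c μ) (h0 : ∀ᵐ ω ∂μ, 0 ≤ c ω)
    (hnc : ¬ ∃ r : ℝ, ∀ᵐ ω ∂μ, c ω = r) {n u : ℝ}
    (hE : ((n + u : ℝ) : EReal) < extIntegral μ c) : ∃ X, IsParameter μ c n u X := by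
  by_cases h : ∀ y, 0 < y → n + u < harmonicShift μ c y
  · exact ⟨0, Or.inl ⟨rfl, h⟩⟩
  push Not at h
  obtain ⟨y, hy, hky⟩ := h
  obtain ⟨z, hz, hMz⟩ := exists_lt_stationaryShift hc h0 hE
  have hkz := hMz.trans (stationaryShift_lt_harmonicShift hc h0 hnc hz)
  have hcon : ContinuousOn (harmonicShift μ c) (Set.Ioi 0) := fun x hx =>
    (hasDerivAt_harmonicShift hc h0 hx).continuousAt.continuousWithinAt
  obtain ⟨X, hX, hkX⟩ := isPreconnected_Ioi.intermediate_value hy hz hcon ⟨hky, hkz.le⟩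
  exact ⟨X, Or.inr ⟨hX, hkX⟩⟩

end Optimal

/-! ### The peak price: uniqueness and existence. -/

theorem coe_lt_sub_coe_iff (E : EReal) (p q : ℝ) :
    (p : EReal) < E - (q : EReal) ↔ ((q + p : ℝ) : EReal) < E := by
  induction E using EReal.rec with
  | bot => simp
  | top => simp [EReal.coe_lt_top, -EReal.coe_add]
  | coe E =>
    rw [← EReal.coe_sub, EReal.coe_lt_coe_iff, EReal.coe_lt_coe_iff, lt_sub_iff_add_lt']

theorem eventually_tendsToLeft {E : EReal} {e : ℝ} (he : (e : EReal) < E) :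
    ∀ᶠ m in tendsToLeft E, e < m ∧ (m : EReal) < E := by
  filter_upwards [preimage_mem_comap (m := fun m : ℝ => (m : EReal)) (Ioo_mem_nhdsLT he)] with m hm
  exact ⟨EReal.coe_lt_coe_iff.1 hm.1, hm.2⟩

theorem IsPeakPrice.not_lt {μ : Measure Ω} {b : Ω → ℝ} {v w : ℝ} (hv : IsPeakPrice μ b v)
    (hw : IsPeakPrice μ b w) : ¬ v < w := by
  intro h
  obtain ⟨p, hp1, hp2⟩ := exists_between h
  obtain ⟨q, hq1, hq2⟩ := exists_between hp2
  have hE : ∀ r : ℝ, r < w → (r : EReal) < extIntegral μ b := fun r hr =>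
    (EReal.coe_lt_coe_iff.2 hr).trans hw.2.1
  have h1 := hw.2.2.1 ⟨hv.1.trans hp1, hp2⟩ ⟨hv.1.trans (hp1.trans hq1), hq2⟩ hq1
  have h2 := hv.2.2.2 ⟨hp1, hE p hp2⟩ ⟨hp1.trans hq1, hE q hq2⟩ hq1
  exact lt_asymm h1 h2

theorem IsPeakPrice.unique {μ : Measure Ω} {b : Ω → ℝ} {v w : ℝ} (hv : IsPeakPrice μ b v)
    (hw : IsPeakPrice μ b w) : v = w :=
  le_antisymm (le_of_not_gt (hw.not_lt hv)) (le_of_not_gt (hv.not_lt hw))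

section Peak

variable {μ : Measure Ω} [IsProbabilityMeasure μ] {c : Ω → ℝ}

theorem add_harmonicShift_pos (hc : AEMeasurable c μ) (h0 : ∀ᵐ ω ∂μ, 0 ≤ c ω) {x : ℝ}
    (hx : 0 < x) : 0 < x + harmonicShift μ c x := by
  linarith [harmonicShift_nonneg hc h0 hx]

theorem interiorProportion_eq (hc : AEMeasurable c μ) (h0 : ∀ᵐ ω ∂μ, 0 ≤ c ω) (n : ℝ) {x : ℝ}
    (hx : 0 < x) :
    interiorProportion μ c n x = (harmonicShift μ c x - n) / (x + harmonicShift μ c x) := by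
  have h1 := invMoment_pos hc h0 hx 1
  rw [interiorProportion, harmonicShift]
  field_simp
  ring

theorem interiorProportion_lt (hc : AEMeasurable c μ) (h0 : ∀ᵐ ω ∂μ, 0 ≤ c ω) {n x y : ℝ}
    (hx : 0 < x) (hxy : x < y) (h : ∀ z, x < z → z < y → stationaryShift μ c z < n) :
    interiorProportion μ c n x < interiorProportion μ c n y := by
  have : StrictMonoOn (interiorProportion μ c n) (Set.Icc x y) := by
    refine strictMonoOn_of_deriv_pos (convex_Icc x y) (fun z hz =>
      (hasDerivAt_interiorProportion hc h0 n
        (hx.trans_le hz.1)).continuousAt.continuousWithinAt) fun z hz => ?_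
    rw [interior_Icc] at hz
    have hz0 := hx.trans hz.1
    rw [(hasDerivAt_interiorProportion hc h0 n hz0).deriv]
    exact mul_pos (invMoment_pos hc h0 hz0 2) (sub_pos.2 (h z hz.1 hz.2))
  exact this (Set.left_mem_Icc.2 hxy.le) (Set.right_mem_Icc.2 hxy.le) hxy

theorem lt_interiorProportion (hc : AEMeasurable c μ) (h0 : ∀ᵐ ω ∂μ, 0 ≤ c ω) {n x y : ℝ}
    (hx : 0 < x) (hxy : x < y) (h : ∀ z, x < z → z < y → n < stationaryShift μ c z) :
    interiorProportion μ c n y < interiorProportion μ c n x := by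
  have : StrictAntiOn (interiorProportion μ c n) (Set.Icc x y) := by
    refine strictAntiOn_of_deriv_neg (convex_Icc x y) (fun z hz =>
      (hasDerivAt_interiorProportion hc h0 n
        (hx.trans_le hz.1)).continuousAt.continuousWithinAt) fun z hz => ?_
    rw [interior_Icc] at hz
    have hz0 := hx.trans hz.1
    rw [(hasDerivAt_interiorProportion hc h0 n hz0).deriv]
    exact mul_neg_of_pos_of_neg (invMoment_pos hc h0 hz0 2) (sub_neg.2 (h z hz.1 hz.2))
  exact this (Set.left_mem_Icc.2 hxy.le) (Set.right_mem_Icc.2 hxy.le) hxy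

theorem optimalProportion_eq_interiorProportion (hc : AEMeasurable c μ)
    (h0 : ∀ᵐ ω ∂μ, 0 ≤ c ω) (hnc : ¬ ∃ r : ℝ, ∀ᵐ ω ∂μ, c ω = r) (hξ : essInf c μ = 0)
    {n u X : ℝ} (hn : 0 < n) (hu : 0 < u) (hX : 0 < X) (hk : harmonicShift μ c X = n + u) :
    optimalProportion μ (fun ω => c ω - n) u = interiorProportion μ c n X := by
  rw [optimalProportion_eq hc h0 hnc hξ hn hu (Or.inr ⟨hX, hk⟩), interiorProportion_eq hc h0 n hX,
    hk]
  congr 1 <;> ring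

/-- Let `x₀ ≥ 0` separate the parameters of increase from those of decrease, and let `v` be the
price at `x₀`.  Then `v` is the peak price. -/
theorem isPeakPrice_of_separated (hc : AEMeasurable c μ)
    (h0 : ∀ᵐ ω ∂μ, 0 ≤ c ω) (hnc : ¬ ∃ r : ℝ, ∀ᵐ ω ∂μ, c ω = r) (hξ : essInf c μ = 0)
    {n v x₀ : ℝ} (hn : 0 < n) (hv : 0 < v)
    (hE : ((n + v : ℝ) : EReal) < extIntegral μ c)
    (hM₁ : ∀ y, 0 < y → y < x₀ → stationaryShift μ c y < n)
    (hM₂ : ∀ y, x₀ < y → n < stationaryShift μ c y)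
    (hk₁ : ∀ y, 0 < y → y < x₀ → harmonicShift μ c y < n + v)
    (hk₂ : ∀ y, x₀ < y → n + v < harmonicShift μ c y)
    (hk₃ : ∀ w, v < w → ∃ y, 0 < y ∧ harmonicShift μ c y < n + w) :
    IsPeakPrice μ (fun ω => c ω - n) v := by
  have hmono := strictMonoOn_harmonicShift hc h0 hnc
  rw [IsPeakPrice, extIntegral_sub_const hc h0]
  simp only [coe_lt_sub_coe_iff]
  refine ⟨hv, hE, ?_, ?_⟩
  · rintro u₁ ⟨hu₁, hv₁⟩ u₂ ⟨hu₂, hv₂⟩ h12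
    have hlt : ∀ u, u < v → ((n + u : ℝ) : EReal) < extIntegral μ c := fun u hu =>
      (EReal.coe_lt_coe_iff.2 (by linarith)).trans hE
    obtain ⟨X₁, hX₁⟩ := exists_isParameter hc h0 hnc (hlt u₁ hv₁)
    obtain ⟨X₂, hX₂⟩ := exists_isParameter hc h0 hnc (hlt u₂ hv₂)
    -- If X₂ = 0 then X₁ = 0 is a parameter too, and u/(n + u) increases with u.
    rcases hX₂ with ⟨rfl, hb₂⟩ | ⟨hp₂, he₂⟩
    · have hb₁ : IsParameter μ c n u₁ 0 :=
        Or.inl ⟨rfl, fun y hy => lt_trans (by linarith) (hb₂ y hy)⟩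
      rw [optimalProportion_eq hc h0 hnc hξ hn hu₁ hb₁,
        optimalProportion_eq hc h0 hnc hξ hn hu₂ (Or.inl ⟨rfl, hb₂⟩),
        div_lt_div_iff₀ (by linarith) (by linarith)]
      nlinarith
    · rw [optimalProportion_eq_interiorProportion hc h0 hnc hξ hn hu₂ hp₂ he₂]
      have hX₂ : X₂ ≤ x₀ := by
        by_contra! hcon
        linarith [hk₂ _ hcon]
      rcases hX₁ with ⟨rfl, hb₁⟩ | ⟨hp₁, he₁⟩
      · rw [optimalProportion_eq hc h0 hnc hξ hn hu₁ (Or.inl ⟨rfl, hb₁⟩)]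
        -- Boundary against interior: the value at u₁ is a limit as y → 0⁺ of quantities below the
        -- interior proportion at y. The interval from X₂/2 to X₂ keeps the inequality strict.
        have hhalf : 0 < X₂ / 2 := by linarith
        refine lt_of_le_of_lt ?_ (interiorProportion_lt hc h0 hhalf (half_lt_self hp₂)
          fun z hz1 hz2 => hM₁ z (hhalf.trans hz1) (hz2.trans_le hX₂))
        have hlim : Tendsto (fun y : ℝ => u₁ / (y + n + u₁)) (𝓝[>] 0) (𝓝 (u₁ / (0 + n + u₁))) := by
          have : ContinuousAt (fun y : ℝ => u₁ / (y + n + u₁)) 0 :=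
            continuousAt_const.div ((continuousAt_id.add continuousAt_const).add
              continuousAt_const) (ne_of_gt (by linarith))
          exact this.tendsto.mono_left nhdsWithin_le_nhds
        refine le_of_tendsto hlim ?_
        filter_upwards [Ioo_mem_nhdsGT hhalf] with y hy
        refine le_trans ?_ (interiorProportion_lt hc h0 hy.1 hy.2 fun z hz1 hz2 =>
          hM₁ z (hy.1.trans hz1) (by linarith)).le
        have h1 := hb₁ y hy.1
        have h2 := hy.1
        rw [interiorProportion_eq hc h0 n hy.1, div_le_div_iff₀ (by linarith) (by linarith)]
        nlinarith
      · rw [optimalProportion_eq_interiorProportion hc h0 hnc hξ hn hu₁ hp₁ he₁]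
        have hX12 : X₁ < X₂ := (hmono.lt_iff_lt hp₁ hp₂).1 (by linarith)
        exact interiorProportion_lt hc h0 hp₁ hX12 fun z hz1 hz2 =>
          hM₁ z (hp₁.trans hz1) (hz2.trans_le hX₂)
  · rintro u₁ ⟨hv₁, hE₁⟩ u₂ ⟨hv₂, hE₂⟩ h12
    have hpos : ∀ u, v < u → ∀ X, IsParameter μ c n u X → 0 < X ∧ harmonicShift μ c X = n + u := by
      intro u hu X hX
      rcases hX with ⟨-, hb⟩ | h
      · obtain ⟨y, hy, hky⟩ := hk₃ u hu
        exact absurd hky (not_lt.2 (hb y hy).le)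
      · exact h
    obtain ⟨X₁, hX₁⟩ := exists_isParameter hc h0 hnc hE₁
    obtain ⟨X₂, hX₂⟩ := exists_isParameter hc h0 hnc hE₂
    obtain ⟨hp₁, he₁⟩ := hpos _ hv₁ _ hX₁
    obtain ⟨hp₂, he₂⟩ := hpos _ hv₂ _ hX₂
    rw [optimalProportion_eq_interiorProportion hc h0 hnc hξ hn (hv.trans hv₁) hp₁ he₁,
      optimalProportion_eq_interiorProportion hc h0 hnc hξ hn (hv.trans hv₂) hp₂ he₂]
    have hX12 : X₁ < X₂ := (hmono.lt_iff_lt hp₁ hp₂).1 (by linarith)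
    have hX₁ : x₀ ≤ X₁ := by
      by_contra! hcon
      linarith [hk₁ _ hp₁ hcon]
    exact lt_interiorProportion hc h0 hp₁ hX12 fun z hz1 _ => hM₂ z (hX₁.trans_lt hz1)

theorem isPeakPrice_of_stationaryShift_eq (hc : AEMeasurable c μ)
    (h0 : ∀ᵐ ω ∂μ, 0 ≤ c ω) (hnc : ¬ ∃ r : ℝ, ∀ᵐ ω ∂μ, c ω = r) (hξ : essInf c μ = 0)
    {n x : ℝ} (hn : 0 < n) (hx : 0 < x) (hM : stationaryShift μ c x = n) :
    IsPeakPrice μ (fun ω => c ω - n) (harmonicShift μ c x - n) := by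
  have hk := strictMonoOn_harmonicShift hc h0 hnc
  have hMm := strictMonoOn_stationaryShift hc h0 hnc
  refine isPeakPrice_of_separated (x₀ := x) hc h0 hnc hξ hn ?_ ?_ ?_ ?_ ?_ ?_ ?_
  · linarith [stationaryShift_lt_harmonicShift hc h0 hnc hx]
  · rw [add_sub_cancel]
    exact harmonicShift_lt_extIntegral hc h0 hnc hx
  · exact fun y hy hyx => hM ▸ hMm hy hx hyx
  · exact fun y hyx => hM ▸ hMm hx (hx.trans hyx) hyx
  · intro y hy hyx
    rw [add_sub_cancel]
    exact hk hy hx hyx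
  · intro y hyx
    rw [add_sub_cancel]
    exact hk hx (hx.trans hyx) hyx
  · exact fun w hw => ⟨x, hx, by linarith⟩

/-- If M never equals n, then M > n everywhere and the peak is κ - n with κ = inf K: below it the
optimum is the boundary value, above it the interior proportion decreases. -/
theorem exists_isPeakPrice (hc : AEMeasurable c μ)
    (h0 : ∀ᵐ ω ∂μ, 0 ≤ c ω) (hnc : ¬ ∃ r : ℝ, ∀ᵐ ω ∂μ, c ω = r) (hξ : essInf c μ = 0)
    {n : ℝ} (hn : 0 < n) (hE : (n : EReal) < extIntegral μ c) :
    ∃ v, IsPeakPrice μ (fun ω => c ω - n) v := by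
  by_cases hex : ∃ x, 0 < x ∧ stationaryShift μ c x = n
  · obtain ⟨x, hx, hM⟩ := hex
    exact ⟨_, isPeakPrice_of_stationaryShift_eq hc h0 hnc hξ hn hx hM⟩
  have hMn : ∀ y, 0 < y → n < stationaryShift μ c y := by
    intro y hy
    by_contra! hcon
    obtain ⟨z, hz, hMz⟩ := exists_lt_stationaryShift hc h0 hE
    have hcont : ContinuousOn (stationaryShift μ c) (Set.Ioi 0) := fun x hx =>
      (hasDerivAt_stationaryShift hc h0 hx).continuousAt.continuousWithinAt
    obtain ⟨X, hX, hMX⟩ := isPreconnected_Ioi.intermediate_value hy hz hcont ⟨hcon, hMz.le⟩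
    exact hex ⟨X, hX, hMX⟩
  have hk := strictMonoOn_harmonicShift hc h0 hnc
  have hkn : ∀ y, 0 < y → n < harmonicShift μ c y := fun y hy =>
    (hMn y hy).trans (stationaryShift_lt_harmonicShift hc h0 hnc hy)
  have hone : 0 < interiorProportion μ c n 1 := by
    rw [interiorProportion_eq hc h0 n one_pos]
    exact div_pos (sub_pos.2 (hkn 1 one_pos)) (add_harmonicShift_pos hc h0 one_pos)
  -- Needed for κ > n: K - n is the interior proportion times y + K, and that proportion is at least
  -- its value at 1 because it decreases.
  have hgap : ∀ y, 0 < y → y ≤ 1 → n + n * interiorProportion μ c n 1 ≤ harmonicShift μ c y := by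
    intro y hy hy1
    have h1 : interiorProportion μ c n 1 ≤ interiorProportion μ c n y := by
      rcases hy1.eq_or_lt with rfl | hlt
      · exact le_rfl
      · exact (lt_interiorProportion hc h0 hy hlt fun z hz _ => hMn z (hy.trans hz)).le
    have h2 := interiorProportion_eq hc h0 n hy
    have h3 := add_harmonicShift_pos hc h0 hy
    rw [eq_div_iff h3.ne'] at h2
    have h4 := hkn y hy
    have h5 : n * interiorProportion μ c n 1 ≤
        interiorProportion μ c n y * (y + harmonicShift μ c y) := by
      rw [mul_comm]
      exact mul_le_mul h1 (by linarith) hn.le (hone.le.trans h1)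
    linarith
  have hgap' : ∀ y, 0 < y → n + n * interiorProportion μ c n 1 ≤ harmonicShift μ c y := by
    intro y hy
    rcases le_or_gt y 1 with h | h
    · exact hgap y hy h
    · exact (hgap 1 one_pos le_rfl).trans (hk (Set.mem_Ioi.2 one_pos) hy h).le
  set κ := sInf (harmonicShift μ c '' Set.Ioi 0) with hκ
  have hne : (harmonicShift μ c '' Set.Ioi 0).Nonempty := ⟨_, 1, Set.mem_Ioi.2 one_pos, rfl⟩
  have hlb : n + n * interiorProportion μ c n 1 ≤ κ := by
    refine le_csInf hne ?_
    rintro _ ⟨y, hy, rfl⟩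
    exact hgap' y hy
  have hκle : ∀ y, 0 < y → κ ≤ harmonicShift μ c y := by
    intro y hy
    refine csInf_le ⟨0, ?_⟩ ⟨y, hy, rfl⟩
    rintro _ ⟨y, hy, rfl⟩
    exact harmonicShift_nonneg hc h0 hy
  refine ⟨κ - n, isPeakPrice_of_separated (x₀ := 0) hc h0 hnc hξ hn ?_ ?_ ?_ hMn ?_ ?_ ?_⟩
  · linarith [mul_pos hn hone]
  · rw [add_sub_cancel]
    exact (EReal.coe_le_coe_iff.2 (hκle 1 one_pos)).trans_lt
      (harmonicShift_lt_extIntegral hc h0 hnc one_pos)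
  · exact fun y h1 h2 => absurd h2 h1.not_gt
  · exact fun y h1 h2 => absurd h2 h1.not_gt
  · intro y hy
    rw [add_sub_cancel]
    exact (hκle (y / 2) (by linarith)).trans_lt
      (hk (show (0 : ℝ) < y / 2 by linarith) hy (half_lt_self hy))
  · intro w hw
    obtain ⟨_, ⟨y, hy, rfl⟩, hyw⟩ := exists_lt_of_csInf_lt hne (show κ < n + w by linarith)
    exact ⟨y, hy, hyw⟩

end Peak

/-! ### The derivative of the peak price and its lower bound. -/

section Derivative

variable {μ : Measure Ω} [IsProbabilityMeasure μ] {c : Ω → ℝ}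

theorem uMax_of_stationaryShift_eq (hc : AEMeasurable c μ)
    (h0 : ∀ᵐ ω ∂μ, 0 ≤ c ω) (hnc : ¬ ∃ r : ℝ, ∀ᵐ ω ∂μ, c ω = r) (hξ : essInf c μ = 0)
    {n x : ℝ} (hn : 0 < n) (hx : 0 < x) (hM : stationaryShift μ c x = n) :
    uMax μ c n = harmonicShift μ c x - n :=
  have h := isPeakPrice_of_stationaryShift_eq hc h0 hnc hξ hn hx hM
  IsPeakPrice.unique (Classical.epsilon_spec ⟨_, h⟩) h

theorem exists_stationaryShift_eq (hc : AEMeasurable c μ) (h0 : ∀ᵐ ω ∂μ, 0 ≤ c ω)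
    (hnc : ¬ ∃ r : ℝ, ∀ᵐ ω ∂μ, c ω = r) {n y : ℝ} (hy : 0 < y)
    (h1 : stationaryShift μ c y < n) (hE : (n : EReal) < extIntegral μ c) :
    ∃ x, y < x ∧ stationaryShift μ c x = n := by
  obtain ⟨z, hz, hMz⟩ := exists_lt_stationaryShift hc h0 hE
  have hcont : ContinuousOn (stationaryShift μ c) (Set.Ioi 0) := fun x hx =>
    (hasDerivAt_stationaryShift hc h0 hx).continuousAt.continuousWithinAt
  obtain ⟨X, hX, hMX⟩ := isPreconnected_Ioi.intermediate_value hy hz hcont ⟨h1.le, hMz.le⟩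
  refine ⟨X, ?_, hMX⟩
  rw [← (strictMonoOn_stationaryShift hc h0 hnc).lt_iff_lt hy hX, hMX]
  exact h1

theorem hasDerivAt_uMax (hc : AEMeasurable c μ)
    (h0 : ∀ᵐ ω ∂μ, 0 ≤ c ω) (hnc : ¬ ∃ r : ℝ, ∀ᵐ ω ∂μ, c ω = r) (hξ : essInf c μ = 0)
    {x : ℝ} (hx : 0 < x) :
    HasDerivAt (uMax μ c)
      ((invMoment μ c 2 x / invMoment μ c 1 x ^ 2 - 1) *
        (2 * (invMoment μ c 1 x * invMoment μ c 3 x - invMoment μ c 2 x ^ 2) /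
          invMoment μ c 2 x ^ 2)⁻¹ - 1) (stationaryShift μ c x) := by
  have hMm := strictMonoOn_stationaryShift hc h0 hnc
  set X : ℝ → ℝ := fun n => Classical.epsilon fun y => 0 < y ∧ stationaryShift μ c y = n with hXdef
  have hhalf : 0 < x / 2 := by linarith
  have hspec : ∀ n, stationaryShift μ c (x / 2) < n → (n : EReal) < extIntegral μ c →
      0 < X n ∧ stationaryShift μ c (X n) = n := by
    intro n hn hE
    obtain ⟨y, hy, hMy⟩ := exists_stationaryShift_eq hc h0 hnc hhalf hn hE
    exact Classical.epsilon_spec (p := fun y => 0 < y ∧ stationaryShift μ c y = n)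
      ⟨y, hhalf.trans hy, hMy⟩
  have hlo := hMm hhalf hx (half_lt_self hx)
  have hhi := hMm hx (show (0 : ℝ) < x + 1 by linarith) (lt_add_one x)
  have hev : ∀ᶠ n in 𝓝 (stationaryShift μ c x), stationaryShift μ c (x / 2) < n ∧
      0 < X n ∧ stationaryShift μ c (X n) = n := by
    filter_upwards [Ioo_mem_nhds hlo hhi] with n hn
    refine ⟨hn.1, hspec n hn.1 ?_⟩
    exact (EReal.coe_lt_coe_iff.2 (hn.2.trans (stationaryShift_lt_harmonicShift hc h0 hnc
      (by linarith)))).trans (harmonicShift_lt_extIntegral hc h0 hnc (by linarith))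
  have hXx : X (stationaryShift μ c x) = x := by
    obtain ⟨-, h1, h2⟩ := hev.self_of_nhds
    exact hMm.injOn h1 hx h2
  -- Continuity of the local inverse of M follows from strict monotonicity; the maximum with x/2
  -- keeps comparison points positive.
  have hcont : ContinuousAt X (stationaryShift μ c x) := by
    rw [ContinuousAt, hXx, tendsto_order]
    constructor
    · intro b hb
      have hb' : max b (x / 2) < x := max_lt hb (half_lt_self hx)
      have hb0 : 0 < max b (x / 2) := lt_max_of_lt_right hhalf
      filter_upwards [hev, lt_mem_nhds (hMm hb0 hx hb')] with n hn h1
      refine (le_max_left b (x / 2)).trans_lt ?_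
      rw [← hMm.lt_iff_lt hb0 hn.2.1, hn.2.2]
      exact h1
    · intro b hb
      filter_upwards [hev, gt_mem_nhds (hMm hx (hx.trans hb) hb)] with n hn h1
      rw [← hMm.lt_iff_lt hn.2.1 (hx.trans hb), hn.2.2]
      exact h1
  have hM' : HasDerivAt (stationaryShift μ c) _ (X (stationaryShift μ c x)) :=
    hXx.symm ▸ hasDerivAt_stationaryShift hc h0 hx
  have hX' := HasDerivAt.of_local_left_inverse hcont hM'
    (hXx.symm ▸ (stationaryShift_deriv_pos hc h0 hnc hx).ne') (hev.mono fun n hn => hn.2.2)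
  have hk' : HasDerivAt (harmonicShift μ c) _ (X (stationaryShift μ c x)) :=
    hXx.symm ▸ hasDerivAt_harmonicShift hc h0 hx
  have hd := (hk'.comp (stationaryShift μ c x) hX').sub (hasDerivAt_id (stationaryShift μ c x))
  rw [hXx] at hd
  refine hd.congr_of_eventuallyEq ?_
  filter_upwards [hev] with n hn
  exact uMax_of_stationaryShift_eq hc h0 hnc hξ
    ((stationaryShift_nonneg hc h0 hhalf).trans_lt hn.1) hn.2.1 hn.2.2

/-- Two losses only: `invMoment_gap_le` for the denominator M', and G₂² ≥ G₁⁴ for the remaining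
factor. -/
theorem deriv_uMax_ge (hc : AEMeasurable c μ)
    (h0 : ∀ᵐ ω ∂μ, 0 ≤ c ω) (hnc : ¬ ∃ r : ℝ, ∀ᵐ ω ∂μ, c ω = r) (hξ : essInf c μ = 0)
    {x : ℝ} (hx : 0 < x) :
    x * invMoment μ c 1 x / 2 - 1 ≤ deriv (uMax μ c) (stationaryShift μ c x) := by
  rw [(hasDerivAt_uMax hc h0 hnc hξ hx).deriv]
  have g1 := invMoment_pos hc h0 hx 1
  have g2 := invMoment_pos hc h0 hx 2
  have hV := sq_invMoment_one_lt hc h0 hnc hx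
  have hD := sq_invMoment_two_lt hc h0 hnc hx
  have hg := invMoment_gap_le hc h0 hx
  set G1 := invMoment μ c 1 x
  set G2 := invMoment μ c 2 x
  set D := G1 * invMoment μ c 3 x - G2 ^ 2 with hDdef
  have hD0 : 0 < D := sub_pos.2 hD
  have e : (G2 / G1 ^ 2 - 1) * (2 * D / G2 ^ 2)⁻¹ = (G2 - G1 ^ 2) * G2 ^ 2 / (2 * D * G1 ^ 2) := by
    field_simp
  rw [e]
  refine sub_le_sub_right ?_ 1
  rw [div_le_div_iff₀ two_pos (by positivity)]
  have h1 : G1 ^ 4 ≤ G2 ^ 2 := by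
    have := pow_le_pow_left₀ (by positivity) hV.le 2
    calc G1 ^ 4 = (G1 ^ 2) ^ 2 := by ring
      _ ≤ _ := this
  calc x * G1 * (2 * D * G1 ^ 2) = 2 * G1 ^ 3 * (x * D) := by ring
    _ ≤ 2 * G1 ^ 3 * (G1 * (G2 - G1 ^ 2)) := by gcongr
    _ = (G2 - G1 ^ 2) * G1 ^ 4 * 2 := by ring
    _ ≤ (G2 - G1 ^ 2) * G2 ^ 2 * 2 := by
      have : 0 ≤ G2 - G1 ^ 2 := sub_nonneg.2 hV.le
      gcongr

end Derivative

end Game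

/-! ### Reduction to essential infimum zero, and the limit. -/

theorem corollary3p16 {Ω : Type*} [MeasurableSpace Ω] (μ : Measure Ω) [IsProbabilityMeasure μ]
    (a : Ω → ℝ) (ha : AEMeasurable a μ)
    (hbdd : ∃ B : ℝ, ∀ᵐ x ∂μ, B ≤ a x)
    (hconst : ¬ ∃ k : ℝ, ∀ᵐ x ∂μ, a x = k) :
    (∀ m : ℝ, essInf a μ < m → (m : EReal) < Game.extIntegral μ a →
      (∀ u : ℝ, 0 < u → (u : EReal) < Game.extIntegral μ a - (m : EReal) →
        ∃! t : ℝ, Game.IsOptimalProportion μ (fun x => a x - m) u t) ∧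
      ∃! v : ℝ, Game.IsPeakPrice μ (fun x => a x - m) v) ∧
    (∀ᶠ m in Game.tendsToLeft (Game.extIntegral μ a),
      DifferentiableAt ℝ (Game.uMax μ a) m) ∧
    ((-(1 / 2) : ℝ) : EReal) ≤
      liminf (fun m : ℝ => ((deriv (Game.uMax μ a) m : ℝ) : EReal))
        (Game.tendsToLeft (Game.extIntegral μ a)) := by
  obtain ⟨B, hB⟩ := hbdd
  set ξ := essInf a μ with hξdef
  set c : Ω → ℝ := fun x => a x - ξ with hcdef
  have hc : AEMeasurable c μ := ha.sub_const ξ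
  have h0 : ∀ᵐ ω ∂μ, 0 ≤ c ω := by
    filter_upwards [ae_essInf_le (isBoundedUnder_of_eventually_ge hB)] with ω hω
    exact sub_nonneg.2 hω
  have hnc : ¬ ∃ r : ℝ, ∀ᵐ ω ∂μ, c ω = r := by
    rintro ⟨r, hr⟩
    exact hconst ⟨r + ξ, hr.mono fun ω hω => by rw [← hω]; simp [hcdef]⟩
  have hξ : essInf c μ = 0 := by
    rw [hcdef, Game.essInf_sub_const hB, ← hξdef, sub_self]
  have hb : ∀ m, (fun x => a x - m) = fun x => c x - (m - ξ) := by
    intro m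
    ext x
    simp only [hcdef]
    ring
  have hE : ∀ p : ℝ, (p : EReal) < Game.extIntegral μ c ↔
      ((ξ + p : ℝ) : EReal) < Game.extIntegral μ a := by
    intro p
    rw [hcdef, Game.extIntegral_sub_const ha hB, Game.coe_lt_sub_coe_iff]
  have huMax : Game.uMax μ a = fun m => Game.uMax μ c (m - ξ) := by
    ext m
    rw [Game.uMax, Game.uMax, hb m]
  -- The limit m → E becomes x → ∞, for finite and infinite E alike.
  have hfar : ∀ y : ℝ, 0 < y → ∀ᶠ m in Game.tendsToLeft (Game.extIntegral μ a),
      ∃ x, y < x ∧ Game.stationaryShift μ c x = m - ξ := by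
    intro y hy
    have hlt : ((ξ + Game.stationaryShift μ c y : ℝ) : EReal) < Game.extIntegral μ a :=
      (hE _).1 ((EReal.coe_lt_coe_iff.2 (Game.stationaryShift_lt_harmonicShift hc h0 hnc hy)).trans
        (Game.harmonicShift_lt_extIntegral hc h0 hnc hy))
    filter_upwards [Game.eventually_tendsToLeft hlt] with m hm
    refine Game.exists_stationaryShift_eq hc h0 hnc hy (by linarith [hm.1]) ((hE _).2 ?_)
    rw [add_sub_cancel]
    exact hm.2
  refine ⟨fun m hm hmE => ⟨fun u hu huE => ?_, ?_⟩, ?_, ?_⟩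
  · rw [Game.coe_lt_sub_coe_iff] at huE
    have hn : 0 < m - ξ := sub_pos.2 hm
    obtain ⟨X, hX⟩ := Game.exists_isParameter (n := m - ξ) (u := u) hc h0 hnc
      ((hE _).2 (by rwa [← add_assoc, add_sub_cancel]))
    rw [hb m]
    exact ⟨_, Game.isOptimalProportion_of_isParameter hc h0 hξ hn hu hX,
      fun t ht => Game.eq_of_isOptimalProportion hc h0 hnc hξ hn hu hX ht⟩
  · rw [hb m]
    obtain ⟨v, hv⟩ := Game.exists_isPeakPrice hc h0 hnc hξ (sub_pos.2 hm)
      ((hE _).2 (by rwa [add_sub_cancel]))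
    exact ⟨v, hv, fun w hw => hw.unique hv⟩
  · filter_upwards [hfar 1 one_pos] with m ⟨x, hx, hMx⟩
    have hd := Game.hasDerivAt_uMax hc h0 hnc hξ (one_pos.trans hx)
    rw [hMx] at hd
    rw [huMax]
    exact (hd.comp_sub_const m ξ).differentiableAt
  · refine le_of_forall_lt fun b hb' => ?_
    obtain ⟨r, hbr, hr⟩ := EReal.lt_iff_exists_real_btwn.1 hb'
    rw [EReal.coe_lt_coe_iff] at hr
    refine hbr.trans_le (le_liminf_of_le (by isBoundedDefault) ?_)
    have hlim := Game.tendsto_mul_invMoment_one hc h0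
    obtain ⟨y, hy⟩ := eventually_atTop.1
      -- The threshold is r < -1/2 rearranged, so that x G₁/2 - 1 exceeds r eventually.
      (hlim.eventually (lt_mem_nhds (show 2 * (r + 1) < 1 by linarith)))
    filter_upwards [hfar (max y 1) (lt_max_of_lt_right one_pos)] with m ⟨x, hx, hMx⟩
    have hx0 : 0 < x := one_pos.trans ((le_max_right y 1).trans_lt hx)
    have h1 := hy x ((le_max_left y 1).trans hx.le)
    have h2 := Game.deriv_uMax_ge hc h0 hnc hξ hx0
    rw [EReal.coe_le_coe_iff, huMax, deriv_comp_sub_const, ← hMx]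
    linarith
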